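/- Let $q$ be a prime power, let $V$ be a vector space of dimension $n$ over the finite field $\mathbb{F}_q$ with $q$ elements, and let $k$ be an integer with $1 \le k \le n/2$. For integers $0 \le j \le m$ write $[m]_q = 1 + q + \cdots + q^{m-1}$, $[m]_q! = [1]_q [2]_q \cdots [m]_q$ (with $[0]_q! = 1$) and $\begin{bmatrix} m \\ j \end{bmatrix}_q = \dfrac{[m]_q!}{[j]_q!\,[m-j]_q!}$. Let $\mathcal{G}_k$ be a family of $k$-dimensional subspaces of $V$ and $\mathcal{G}_{n-k}$ a family of $(n-k)$-dimensional subspaces of $V$, and assume that $\mathcal{G}_k \cup \mathcal{G}_{n-k}$ is intersecting, i.e. $U \cap W \ne \{0\}$ for every pair of subspaces $U, W$ in $\mathcal{G}_k \cup \mathcal{G}_{n-k}$. Let $\alpha$ be a real number with $\alpha \ge 1$ if $k = n/2$, and $\alpha \ge q^{n-k}$ if $k < n/2$. Then $$\alpha\,|\mathcal{G}_k| + |\mathcal{G}_{n-k}| \le \alpha \begin{bmatrix} n-1 \\ k-1 \end{bmatrix}_q + \begin{bmatrix} n-1 \\ k \end{bmatrix}_q .$$ Furthermore, if equality holds, then $|\mathcal{G}_{n-k}|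 \ge \begin{bmatrix} n-1 \\ k \end{bmatrix}_q$. -/

import Mathlib

/-- The `q`-integer `[n]_q = 1 + q + ⋯ + q ^ (n - 1)`. -/
def qInt (q n : ℕ) : ℕ := ∑ i ∈ Finset.range n, q ^ i

/-- The `q`-factorial `[n]_q! = [1]_q [2]_q ⋯ [n]_q`. -/
def qFactorial (q n : ℕ) : ℕ := ∏ i ∈ Finset.range n, qInt q (i + 1)

/-- The Gaussian coefficient `[n]_q! / ([k]_q! [n - k]_q!)` for `0 ≤ k ≤ n`, as a real number;
it is zero for `k > n`. -/
noncomputable def gaussBinom (q n k : ℕ) : ℝ :=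
  if k ≤ n then (qFactorial q n : ℝ) / ((qFactorial q k : ℝ) * (qFactorial q (n - k) : ℝ)) else 0

/-- A family of subspaces is intersecting if any two members of it have an intersection
larger than the zero subspace. (A pair means two different members; for families without
the zero subspace this is the same as allowing equal members.) -/
def IsIntersectingFamily {F V : Type*} [Field F] [AddCommGroup V] [Module F V]
    (S : Set (Submodule F V)) : Prop :=
  ∀ U ∈ S, ∀ W ∈ S, U ≠ W → U ⊓ W ≠ ⊥

/-! ### Identities for q-integers and Gaussian coefficients. -/

section QIdentities

/-! For `k < n/2` the core is `q^(n-k) |G₁| + |G₂| ≤ binom(n, k)`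
(`pow_mul_card_add_card_le_gaussBinom`), from double counting pairs of `U ∈ G₁` and complements `W ∉
G₂`. Each `U` has at least `q^(k(n-k))` complements, all outside `G₂`. Each `W` is complementary to
at most `q^((k-1)(n-k))` members of `G₁`: complements of `W` are graphs of maps into `W`, and a
linear code whose nonzero maps are injective allows one member of an intersecting family per coset
(`card_mul_pow_le_of_complements`).

The same inequality yields Erdős-Ko-Rado. If `|G| > binom(n-1, k-1)`, a Lovász-type shadow bound
gives at least `binom(n-1, k)` subspaces of dimension `n-k` above members of `G`; these
cross-intersect `G`, so the core inequality and Pascal's rule give a contradiction.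

Finally, splitting `α = (α - q^(n-k)) + q^(n-k)` combines the two bounds; for `k = n/2`,
Erdős-Ko-Rado applies to each family. Equality forces the claim on `G₂` because `α |G₁|` cannot
exceed its own term. -/

lemma qInt_succ (q n : ℕ) : qInt q (n + 1) = qInt q n + q ^ n := by
  simp [qInt, Finset.sum_range_succ]

lemma qInt_add (q m n : ℕ) : qInt q (m + n) = qInt q m + q ^ m * qInt q n := by
  simp [qInt, Finset.sum_range_add, Finset.mul_sum, pow_add]

lemma qInt_pos (q n : ℕ) : 0 < qInt q (n + 1) := by
  rw [add_comm, qInt_add]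
  simp [qInt]

lemma qInt_mul_sub (q d a : ℕ) : qInt q d * (q ^ (a + 1) - q ^ a) = q ^ (a + d) - q ^ a := by
  rcases Nat.eq_zero_or_pos q with rfl | hq
  · cases a <;> cases d <;> simp [qInt]
  induction d with
  | zero => simp [qInt]
  | succ d ih =>
    have h1 : q ^ a ≤ q ^ (a + 1) := Nat.pow_le_pow_right hq (by omega)
    have h2 : q ^ a ≤ q ^ (a + d) := Nat.pow_le_pow_right hq (by omega)
    have h3 : q ^ a ≤ q ^ (a + (d + 1)) := Nat.pow_le_pow_right hq (by omega)
    rw [qInt_succ, add_mul, ih]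
    zify [h1, h2, h3]
    ring

lemma qFactorial_succ (q n : ℕ) : qFactorial q (n + 1) = qFactorial q n * qInt q (n + 1) := by
  simp [qFactorial, Finset.prod_range_succ]

lemma qFactorial_pos (q n : ℕ) : 0 < qFactorial q n :=
  Finset.prod_pos fun _ _ => qInt_pos _ _

lemma gaussBinom_zero_right (q n : ℕ) : gaussBinom q n 0 = 1 := by
  have := qFactorial_pos q n
  have h : (qFactorial q n : ℝ) ≠ 0 := by positivity
  have h0 : qFactorial q 0 = 1 := by simp [qFactorial]
  simp [gaussBinom, h, h0]

lemma gaussBinom_self (q n : ℕ) : gaussBinom q n n = 1 := by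
  have := qFactorial_pos q n
  have h : (qFactorial q n : ℝ) ≠ 0 := by positivity
  have h0 : qFactorial q 0 = 1 := by simp [qFactorial]
  simp [gaussBinom, h, h0]

lemma gaussBinom_symm (q a b : ℕ) : gaussBinom q (a + b) a = gaussBinom q (a + b) b := by
  simp [gaussBinom, mul_comm]

lemma qInt_mul_gaussBinom_succ_succ (q n k : ℕ) :
    (qInt q (k + 1) : ℝ) * gaussBinom q (n + 1) (k + 1) = qInt q (n + 1) * gaussBinom q n k := by
  unfold gaussBinom
  by_cases h : k ≤ n
  · rw [if_pos h, if_pos (by omega), Nat.add_sub_add_right, qFactorial_succ, qFactorial_succ]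
    have h1 := qFactorial_pos q k
    have h2 := qFactorial_pos q (n - k)
    have h3 := qInt_pos q k
    push_cast
    field_simp
  · rw [if_neg h, if_neg (by omega)]
    simp

lemma qInt_mul_gaussBinom_succ (q a b : ℕ) :
    (qInt q (b + 1) : ℝ) * gaussBinom q (a + b + 1) a =
      qInt q (a + b + 1) * gaussBinom q (a + b) a := by
  rw [gaussBinom_symm q a b, add_assoc, gaussBinom_symm q a (b + 1), ← add_assoc,
    qInt_mul_gaussBinom_succ_succ]

/-- `[a + 1] * binom(a + b + 1, a + 1) = [b + 1] * binom(a + b + 1, a)`. -/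
lemma qInt_mul_gaussBinom_comm (q a b : ℕ) :
    (qInt q (a + 1) : ℝ) * gaussBinom q (a + b + 1) (a + 1) =
      qInt q (b + 1) * gaussBinom q (a + b + 1) a := by
  rw [qInt_mul_gaussBinom_succ_succ, qInt_mul_gaussBinom_succ]

/-- Pascal's rule for the Gaussian coefficients. -/
lemma gaussBinom_pascal (q a b : ℕ) :
    gaussBinom q (a + b + 1 + 1) (a + 1) =
      gaussBinom q (a + b + 1) (a + 1) + (q : ℝ) ^ (b + 1) * gaussBinom q (a + b + 1) a := by
  have h1 := qInt_mul_gaussBinom_succ q (a + 1) b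
  have h2 := qInt_mul_gaussBinom_succ_succ q (a + b + 1) a
  have h3 : (qInt q (a + b + 1 + 1) : ℝ) = qInt q (b + 1) + (q : ℝ) ^ (b + 1) * qInt q (a + 1) := by
    rw [show a + b + 1 + 1 = (b + 1) + (a + 1) by ring, qInt_add]
    push_cast
    ring
  have h4 : (0 : ℝ) < qInt q (a + b + 1 + 1) := by exact_mod_cast qInt_pos q _
  rw [show a + 1 + b = a + b + 1 by ring] at h1
  apply mul_left_cancel₀ h4.ne'
  rw [mul_add, ← h1, mul_left_comm, ← h2, h3]
  ring

end QIdentities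

/-! ### Counting subspaces in an interval. -/

section Counting

variable {F V : Type*} [Field F] [AddCommGroup V] [Module F V] [Finite V]

open Module Finset

/-- The subspaces of dimension `m` between `A` and `B`. -/
noncomputable def subspacesBetween (A B : Submodule F V) (m : ℕ) : Finset (Submodule F V) :=
  (Set.toFinite {X : Submodule F V | A ≤ X ∧ X ≤ B ∧ finrank F X = m}).toFinset

@[simp] lemma mem_subspacesBetween {A B X : Submodule F V} {m : ℕ} :
    X ∈ subspacesBetween A B m ↔ A ≤ X ∧ X ≤ B ∧ finrank F X = m := by
  simp [subspacesBetween]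

lemma subspacesBetween_finrank_left {A B : Submodule F V} (h : A ≤ B) :
    subspacesBetween A B (finrank F A) = {A} := by
  ext X
  simp only [mem_subspacesBetween, mem_singleton]
  constructor
  · rintro ⟨h1, -, h2⟩
    exact (Submodule.eq_of_le_of_finrank_eq h1 h2.symm).symm
  · rintro rfl
    exact ⟨le_rfl, h, rfl⟩

lemma ncard_submodule_diff {A B : Submodule F V} (h : A ≤ B) :
    ((B : Set V) \ A).ncard = Nat.card F ^ finrank F B - Nat.card F ^ finrank F A := by
  rw [Set.ncard_sdiff (by simpa using h) (Set.toFinite _)]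
  congr 1
  · exact (Nat.card_coe_set_eq (B : Set V)).symm.trans Module.natCard_eq_pow_finrank
  · exact (Nat.card_coe_set_eq (A : Set V)).symm.trans Module.natCard_eq_pow_finrank

lemma finrank_sup_span_singleton {A : Submodule F V} {v : V} (hv : v ∉ A) :
    finrank F ↥(A ⊔ F ∙ v) = finrank F A + 1 := by
  have hv0 : v ≠ 0 := fun h => hv (h ▸ A.zero_mem)
  have h := Submodule.finrank_sup_add_finrank_inf_eq A (F ∙ v)
  have h2 : A ⊓ F ∙ v = ⊥ := ((Submodule.disjoint_span_singleton' hv0).2 hv).eq_bot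
  rw [h2, finrank_bot, finrank_span_singleton hv0] at h
  simpa using h

lemma card_subspacesBetween_succ [Finite F] {A B : Submodule F V} (h : A ≤ B) (d : ℕ)
    (hd : finrank F B = finrank F A + d) :
    #(subspacesBetween A B (finrank F A + 1)) = qInt (Nat.card F) d := by
  classical
  set q := Nat.card F
  set a := finrank F A
  have hq : 1 < q := Finite.one_lt_card
  have key : #(subspacesBetween A B (a + 1)) * (q ^ (a + 1) - q ^ a) = q ^ (a + d) - q ^ a := by
    have hs : ∀ X Y : Submodule F V, X ≤ Y → #(Set.toFinite ((Y : Set V) \ X)).toFinset =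
        q ^ finrank F Y - q ^ finrank F X := fun X Y hXY => by
      rw [← Set.ncard_eq_toFinset_card, ncard_submodule_diff hXY]
    rw [← hd, ← hs A B h]
    symm
    -- Each vector of `B \ A` lies in exactly one one-step overspace of `A`, the one it generates
    -- with `A`.
    rw [card_eq_sum_card_fiberwise (f := fun v => A ⊔ F ∙ v)
      (t := subspacesBetween A B (a + 1)), sum_const_nat]
    · intro X hX
      obtain ⟨h1, h2, h3⟩ := mem_subspacesBetween.1 hX
      rw [← h3, ← hs A X h1]
      congr 1
      ext v
      simp only [mem_filter, Set.Finite.mem_toFinset, Set.mem_sdiff, SetLike.mem_coe]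
      constructor
      · rintro ⟨⟨-, h4⟩, rfl⟩
        exact ⟨Submodule.mem_sup_right (Submodule.mem_span_singleton_self v), h4⟩
      · rintro ⟨h4, h5⟩
        refine ⟨⟨h2 h4, h5⟩, Submodule.eq_of_le_of_finrank_eq ?_ ?_⟩
        · exact sup_le h1 (by simpa using h4)
        · rw [finrank_sup_span_singleton h5, h3]
    · intro v hv
      simp only [Set.Finite.coe_toFinset, Set.mem_sdiff, SetLike.mem_coe] at hv
      simp only [SetLike.mem_coe, mem_subspacesBetween, le_sup_left, true_and]
      exact ⟨sup_le h (by simpa using hv.1), finrank_sup_span_singleton hv.2⟩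
  rw [← qInt_mul_sub q d a] at key
  exact Nat.eq_of_mul_eq_mul_right (Nat.sub_pos_of_lt (Nat.pow_lt_pow_right hq (by omega))) key

/-- The number of `j`-dimensional subspaces is a Gaussian coefficient, relative version. -/
lemma card_subspacesBetween [Finite F] (j : ℕ) : ∀ (d : ℕ) {A B : Submodule F V}, A ≤ B →
    finrank F B = finrank F A + d →
    (#(subspacesBetween A B (finrank F A + j)) : ℝ) = gaussBinom (Nat.card F) d j := by
  classical
  induction j with
  | zero =>
    intro d A B h hd
    rw [add_zero, subspacesBetween_finrank_left h, gaussBinom_zero_right]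
    simp
  | succ j ih =>
    intro d A B h hd
    rcases d with _ | d
    -- Here `gaussBinom` takes its default value zero.
    · have h1 : subspacesBetween A B (finrank F A + (j + 1)) = ∅ := by
        refine eq_empty_of_forall_notMem fun X hX => ?_
        obtain ⟨-, h2, h3⟩ := mem_subspacesBetween.1 hX
        have := Submodule.finrank_mono h2
        omega
      simp [h1, gaussBinom]
    have hdc := sum_card_bipartiteAbove_eq_sum_card_bipartiteBelow (· ≤ ·)
      (s := subspacesBetween A B (finrank F A + 1))
      (t := subspacesBetween A B (finrank F A + (j + 1)))
    have hR : ∑ X ∈ subspacesBetween A B (finrank F A + (j + 1)),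
        #(bipartiteBelow (· ≤ ·) (subspacesBetween A B (finrank F A + 1)) X) =
        #(subspacesBetween A B (finrank F A + (j + 1))) * qInt (Nat.card F) (j + 1) := by
      refine sum_const_nat fun X hX => ?_
      obtain ⟨h1, h2, h3⟩ := mem_subspacesBetween.1 hX
      rw [← card_subspacesBetween_succ h1 (j + 1) h3]
      congr 1
      ext P
      simp only [bipartiteBelow, mem_filter, mem_subspacesBetween]
      grind
    have hL : (∑ P ∈ subspacesBetween A B (finrank F A + 1),
        (#(bipartiteAbove (· ≤ ·) (subspacesBetween A B (finrank F A + (j + 1))) P) : ℝ)) =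
        qInt (Nat.card F) (d + 1) * gaussBinom (Nat.card F) d j := by
      rw [← card_subspacesBetween_succ h (d + 1) hd, ← nsmul_eq_mul, ← sum_const]
      refine sum_congr rfl fun P hP => ?_
      obtain ⟨h1, h2, h3⟩ := mem_subspacesBetween.1 hP
      rw [← ih d h2 (by omega)]
      congr 2
      ext X
      simp only [bipartiteAbove, mem_filter, mem_subspacesBetween, h3]
      constructor
      · rintro ⟨⟨h4, h5, h6⟩, h7⟩
        exact ⟨h7, h5, by omega⟩
      · rintro ⟨h4, h5, h6⟩
        exact ⟨⟨h1.trans h4, h5, by omega⟩, h4⟩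
    have hdc' : (∑ P ∈ subspacesBetween A B (finrank F A + 1),
        (#(bipartiteAbove (· ≤ ·) (subspacesBetween A B (finrank F A + (j + 1))) P) : ℝ)) =
        #(subspacesBetween A B (finrank F A + (j + 1))) * qInt (Nat.card F) (j + 1) := by
      rw [hR] at hdc
      exact_mod_cast hdc
    have hpos : (0 : ℝ) < qInt (Nat.card F) (j + 1) := by exact_mod_cast qInt_pos _ _
    apply mul_left_cancel₀ hpos.ne'
    rw [qInt_mul_gaussBinom_succ_succ, ← hL, hdc', mul_comm]

lemma card_subspacesBetween_pred [Finite F] {A B : Submodule F V} (h : A ≤ B) (d : ℕ)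
    (hd : finrank F B = finrank F A + (d + 1)) :
    #(subspacesBetween A B (finrank F A + d)) = qInt (Nat.card F) (d + 1) := by
  have h1 := card_subspacesBetween d (d + 1) h hd
  have h2 := qInt_mul_gaussBinom_succ (Nat.card F) d 0
  simp only [zero_add, add_zero, gaussBinom_self, mul_one] at h2
  have h3 : (qInt (Nat.card F) 1 : ℝ) = 1 := by simp [qInt]
  rw [h3, one_mul] at h2
  rw [h2] at h1
  exact_mod_cast h1

end Counting

/-! ### A shadow bound of Kruskal-Katona type. -/

section Shadow

variable {F V : Type*} [Field F] [AddCommGroup V] [Module F V] [Finite V]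

open Module Finset

/-- The number of one-step overspaces of `X` in `H` that do not lie in the hyperplane `H'`. -/
lemma card_subspacesBetween_filter_not_le [Finite F] {X H H' : Submodule F V} (hX : X ≤ H')
    (hH : H' ≤ H) (d : ℕ) (hd' : finrank F H' = finrank F X + d)
    (hd : finrank F H = finrank F X + (d + 1)) [DecidablePred fun U : Submodule F V => ¬ U ≤ H'] :
    #{U ∈ subspacesBetween X H (finrank F X + 1) | ¬ U ≤ H'} = Nat.card F ^ d := by
  classical
  have h1 := card_subspacesBetween_succ (hX.trans hH) (d + 1) hd
  have h2 := card_subspacesBetween_succ hX d hd'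
  have h3 := card_filter_add_card_filter_not (s := subspacesBetween X H (finrank F X + 1)) (· ≤ H')
  have h4 : {U ∈ subspacesBetween X H (finrank F X + 1) | U ≤ H'} =
      subspacesBetween X H' (finrank F X + 1) := by
    ext U
    simp only [mem_filter, mem_subspacesBetween]
    constructor
    · rintro ⟨⟨a, b, c⟩, d⟩
      exact ⟨a, d, c⟩
    · rintro ⟨a, b, c⟩
      exact ⟨⟨a, b.trans hH, c⟩, b⟩
  rw [h4, h2, h1, qInt_succ] at h3
  exact Nat.add_left_cancel h3

open scoped Classical in
/-- Averaging over hyperplanes `H'` of `H`: it is enough to treat those `H'` that contain few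
members of `S`. -/
lemma card_mul_qInt_le_of_hyperplanes [Finite F] (k e : ℕ) (H : Submodule F V)
    (S L : Finset (Submodule F V)) (hH : finrank F H = k + 2 + e)
    (hS : ∀ U ∈ S, U ≤ H ∧ finrank F U = k + 1)
    (hL : ∀ X ∈ L, X ≤ H ∧ finrank F X = k ∧ ∀ U, X ≤ U → U ≤ H → finrank F U = k + 1 → U ∈ S)
    (hcard : (#S : ℝ) ≤ gaussBinom (Nat.card F) (k + 1 + e) k)
    (hsmall : ∀ H' ≤ H, finrank F H' = k + 1 + e →
      (#{U ∈ S | U ≤ H'} : ℝ) < gaussBinom (Nat.card F) (k + e) k →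
      (#{X ∈ L | X ≤ H'} : ℝ) * qInt (Nat.card F) (e + 1) ≤
        #{U ∈ S | U ≤ H'} * qInt (Nat.card F) k) :
    (#L : ℝ) * qInt (Nat.card F) (e + 2) ≤ #S * qInt (Nat.card F) k := by
  set q := Nat.card F with hq
  have claim : ∀ H' ∈ subspacesBetween ⊥ H (k + 1 + e),
      (#{X ∈ L | X ≤ H'} : ℝ) * qInt q (e + 1) ≤ #{U ∈ S | U ≤ H'} * qInt q k := by
    intro H' hH'
    obtain ⟨-, hle, hr⟩ := mem_subspacesBetween.1 hH'
    -- If `H'` contains many members of `S`, few remain outside it, and each of those meets `H'` in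
    -- only one candidate for `L`.
    rcases lt_or_ge (#{U ∈ S | U ≤ H'} : ℝ) (gaussBinom q (k + e) k) with hlt | hge
    · exact hsmall H' hle hr hlt
    have hdc : #{X ∈ L | X ≤ H'} * q ^ (e + 1) ≤ #{U ∈ S | ¬ U ≤ H'} * 1 := by
      refine card_mul_le_card_mul (· ≤ ·) (fun X hX => ?_) fun U hU => ?_
      · obtain ⟨hXL, hXH'⟩ := mem_filter.1 hX
        obtain ⟨h1, h2, h3⟩ := hL X hXL
        rw [hq, ← card_subspacesBetween_filter_not_le hXH' hle (e + 1) (by omega) (by omega)]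
        refine card_le_card fun U hU => ?_
        simp only [mem_filter, mem_subspacesBetween, bipartiteAbove] at hU ⊢
        obtain ⟨⟨h4, h5, h6⟩, h7⟩ := hU
        exact ⟨⟨h3 U h4 h5 (by omega), h7⟩, h4⟩
      · obtain ⟨hUS, hUH'⟩ := mem_filter.1 hU
        obtain ⟨h1, h2⟩ := hS U hUS
        refine card_le_one.2 ?_
        have key : ∀ X ∈ bipartiteBelow (· ≤ ·) {X ∈ L | X ≤ H'} U, X = U ⊓ H' := by
          intro X hX
          simp only [bipartiteBelow, mem_filter] at hX
          obtain ⟨⟨h3, h4⟩, h5⟩ := hX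
          refine Submodule.eq_of_le_of_finrank_eq (le_inf h5 h4) ?_
          have h6 : U ⊓ H' < U := inf_lt_left.2 hUH'
          have h7 := Submodule.finrank_lt_finrank_of_lt h6
          have h8 := Submodule.finrank_mono (le_inf h5 h4)
          have h9 := (hL X h3).2.1
          omega
        intro X hX Y hY
        rw [key X hX, key Y hY]
    have hsplit := card_filter_add_card_filter_not (s := S) (· ≤ H')
    have hsplit' : (#{U ∈ S | U ≤ H'} : ℝ) + #{U ∈ S | ¬ U ≤ H'} = #S := by exact_mod_cast hsplit
    have hdc' : (#{X ∈ L | X ≤ H'} : ℝ) * q ^ (e + 1) ≤ #{U ∈ S | ¬ U ≤ H'} := by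
      rw [mul_one] at hdc
      exact_mod_cast hdc
    have hG := qInt_mul_gaussBinom_succ q k e
    rw [show k + e + 1 = k + 1 + e by ring] at hG
    have hI : (qInt q (k + 1 + e) : ℝ) = qInt q (e + 1) + (q : ℝ) ^ (e + 1) * qInt q k := by
      rw [show k + 1 + e = e + 1 + k by ring, qInt_add]
      push_cast
      ring
    have hp : (0 : ℝ) < (q : ℝ) ^ (e + 1) := by
      have : 0 < q := Nat.card_pos
      positivity
    refine le_of_mul_le_mul_left ?_ hp
    set l := (#{X ∈ L | X ≤ H'} : ℝ)
    set s := (#{U ∈ S | U ≤ H'} : ℝ)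
    have h0 : (0 : ℝ) ≤ qInt q (e + 1) := by positivity
    have h0' : (0 : ℝ) ≤ qInt q (k + 1 + e) := by positivity
    calc (q : ℝ) ^ (e + 1) * (l * qInt q (e + 1)) = qInt q (e + 1) * (l * q ^ (e + 1)) := by ring
      _ ≤ qInt q (e + 1) * (gaussBinom q (k + 1 + e) k - s) :=
        mul_le_mul_of_nonneg_left (by linarith) h0
      _ = qInt q (k + 1 + e) * gaussBinom q (k + e) k - qInt q (e + 1) * s := by rw [mul_sub, hG]
      _ ≤ qInt q (k + 1 + e) * s - qInt q (e + 1) * s :=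
        sub_le_sub_right (mul_le_mul_of_nonneg_left hge h0') _
      _ = (q : ℝ) ^ (e + 1) * (s * qInt q k) := by rw [hI]; ring
  have hcount : ∀ (T : Finset (Submodule F V)) (m d : ℕ), m + d = k + 1 + e →
      (∀ X ∈ T, X ≤ H ∧ finrank F X = m) →
      ∑ H' ∈ subspacesBetween ⊥ H (k + 1 + e), #{X ∈ T | X ≤ H'} = #T * qInt q (d + 1) := by
    intro T m d hmd hT
    have := sum_card_bipartiteAbove_eq_sum_card_bipartiteBelow (· ≤ ·)
      (s := T) (t := subspacesBetween ⊥ H (k + 1 + e))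
    refine this.symm.trans (sum_const_nat fun X hX => ?_)
    obtain ⟨h1, h2⟩ := hT X hX
    rw [hq, ← card_subspacesBetween_pred h1 d (by omega)]
    congr 1
    ext H'
    simp only [bipartiteAbove, mem_filter, mem_subspacesBetween, bot_le, true_and, h2, hmd]
    tauto
  -- Members of `L` lie in `[e + 2]` hyperplanes of `H`, members of `S` in `[e + 1]`; the common
  -- factor `[e + 1]` cancels after summing `claim`.
  have hcL := hcount L k (e + 1) (by ring) fun X hX => ⟨(hL X hX).1, (hL X hX).2.1⟩
  have hcS := hcount S (k + 1) e (by ring) hS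
  have hsum := sum_le_sum claim
  rw [← sum_mul, ← sum_mul, ← Nat.cast_sum, ← Nat.cast_sum, hcL, hcS] at hsum
  push_cast at hsum
  have hp : (0 : ℝ) < qInt q (e + 1) := by exact_mod_cast qInt_pos q e
  refine le_of_mul_le_mul_right ?_ hp
  linarith

/-- A family `S` of subspaces of dimension `k + 1` in `H` that is not too large contains all the
one-step overspaces only of few `k`-dimensional subspaces (the dual of the `q`-analogue of the
Kruskal-Katona theorem in Lovász's form). -/
lemma card_mul_qInt_le_of_overspaces_mem [Finite F] (k e : ℕ) :
    ∀ (H : Submodule F V) (S L : Finset (Submodule F V)), finrank F H = k + 2 + e →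
    (∀ U ∈ S, U ≤ H ∧ finrank F U = k + 1) →
    (∀ X ∈ L, X ≤ H ∧ finrank F X = k ∧ ∀ U, X ≤ U → U ≤ H → finrank F U = k + 1 → U ∈ S) →
    (#S : ℝ) ≤ gaussBinom (Nat.card F) (k + 1 + e) k →
    (#L : ℝ) * qInt (Nat.card F) (e + 2) ≤ #S * qInt (Nat.card F) k := by
  classical
  induction e with
  | zero =>
    intro H S L hH hS hL hcard
    refine card_mul_qInt_le_of_hyperplanes k 0 H S L hH hS hL hcard fun H' hle hr hlt => ?_
    rw [add_zero, gaussBinom_self] at hlt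
    have hS0 : #{U ∈ S | U ≤ H'} = 0 := by
      have : #{U ∈ S | U ≤ H'} < 1 := by exact_mod_cast hlt
      omega
    have hL0 : {X ∈ L | X ≤ H'} = ∅ := by
      refine eq_empty_of_forall_notMem fun X hX => ?_
      -- `H'` has dimension `k + 1`, so it is itself an overspace of `X` and would belong to `S`.
      obtain ⟨hXL, hXH'⟩ := mem_filter.1 hX
      have h1 := (hL X hXL).2.2 H' hXH' hle (by omega)
      exact notMem_empty H' (card_eq_zero.1 hS0 ▸ mem_filter.2 ⟨h1, le_rfl⟩)
    simp [hS0, hL0]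
  | succ e ih =>
    intro H S L hH hS hL hcard
    refine card_mul_qInt_le_of_hyperplanes k (e + 1) H S L hH hS hL hcard fun H' hle hr hlt => ?_
    refine ih H' _ _ (by omega) (fun U hU => ?_) (fun X hX => ?_) ?_
    · obtain ⟨h1, h2⟩ := mem_filter.1 hU
      exact ⟨h2, (hS U h1).2⟩
    · obtain ⟨h1, h2⟩ := mem_filter.1 hX
      obtain ⟨-, h3, h4⟩ := hL X h1
      exact ⟨h2, h3, fun U h5 h6 h7 => mem_filter.2 ⟨h4 U h5 (h6.trans hle) h7, h6⟩⟩
    · rw [show k + 1 + e = k + (e + 1) by ring]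
      exact hlt.le

/-- The upper shadow is climbed one dimension at a time: too few members at the next level would, by
the previous bound, force too few at the current one. The bounds are those of the subspaces through
a fixed line. -/
lemma gaussBinom_le_card_overspaces [Finite F] [FiniteDimensional F V] (n k : ℕ)
    (hn : finrank F V = n + 1) (G : Finset (Submodule F V)) (hG : ∀ U ∈ G, finrank F U = k + 1)
    (hcard : gaussBinom (Nat.card F) n k ≤ #G) (j : ℕ) (hj : k + j + 1 ≤ n)
    [DecidablePred fun W : Submodule F V => ∃ U ∈ G, U ≤ W] :
    gaussBinom (Nat.card F) n (k + j) ≤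
      #{W ∈ subspacesBetween (⊥ : Submodule F V) ⊤ (k + j + 1) | ∃ U ∈ G, U ≤ W} := by
  classical
  induction j with
  | zero =>
    refine hcard.trans ?_
    norm_cast
    refine card_le_card fun U hU => ?_
    simp only [mem_filter, mem_subspacesBetween, bot_le, le_top, true_and]
    exact ⟨hG U hU, U, hU, le_rfl⟩
  | succ j ih =>
    specialize ih (by omega)
    set L := {W ∈ subspacesBetween (⊥ : Submodule F V) ⊤ (k + j + 1) | ∃ U ∈ G, U ≤ W} with hLdef
    set S := {W ∈ subspacesBetween (⊥ : Submodule F V) ⊤ (k + (j + 1) + 1) | ∃ U ∈ G, U ≤ W}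
      with hSdef
    by_contra! hlt
    obtain ⟨e, rfl⟩ : ∃ e, n = k + j + 2 + e := ⟨n - (k + j + 2), by omega⟩
    have h1 := card_mul_qInt_le_of_overspaces_mem (k + j + 1) e (⊤ : Submodule F V) S L
      (by rw [finrank_top]; omega)
      (fun U hU => ⟨le_top, (mem_subspacesBetween.1 (mem_filter.1 hU).1).2.2⟩)
      (fun X hX => ?_)
      (by rw [show k + j + 1 + 1 + e = k + j + 2 + e by ring]; exact hlt.le)
    · have h2 := qInt_mul_gaussBinom_comm (Nat.card F) (k + j) (e + 1)
      have e1 : k + j + (e + 1) + 1 = k + j + 2 + e := by ring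
      rw [e1] at h2
      have hp1 : (0 : ℝ) < qInt (Nat.card F) (k + j + 1) := by exact_mod_cast qInt_pos _ _
      have hp2 : (0 : ℝ) < qInt (Nat.card F) (e + 2) := by exact_mod_cast qInt_pos _ _
      have h3 := mul_lt_mul_of_pos_right hlt hp1
      have h4 := mul_le_mul_of_nonneg_right ih hp2.le
      rw [show k + (j + 1) = k + j + 1 by ring] at h3
      rw [show e + 1 + 1 = e + 2 by ring] at h2
      linarith
    · obtain ⟨hX1, U, hU, hUX⟩ := mem_filter.1 hX
      refine ⟨le_top, (mem_subspacesBetween.1 hX1).2.2, fun W hW _ hr => ?_⟩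
      simp only [hSdef, mem_filter, mem_subspacesBetween, bot_le, le_top, true_and]
      exact ⟨by omega, U, hU, hUX.trans hW⟩

end Shadow

/-! ### Complements as graphs, and intersecting families of them. -/

section Complements

variable {F V : Type*} [Field F] [AddCommGroup V] [Module F V]

open Module Finset

/-- The graph `{x + f x | x ∈ U}` of a linear map between two subspaces. -/
def graphIn {U W : Submodule F V} (f : U →ₗ[F] W) : Submodule F V :=
  LinearMap.range (U.subtype + W.subtype ∘ₗ f)

lemma mem_graphIn {U W : Submodule F V} {f : U →ₗ[F] W} {v : V} :
    v ∈ graphIn f ↔ ∃ x : U, (x : V) + f x = v := by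
  simp [graphIn]

lemma eq_zero_of_add_eq_zero {U W : Submodule F V} (h : U ⊓ W = ⊥) {x : U} {w : W}
    (hxw : (x : V) + w = 0) : x = 0 ∧ w = 0 := by
  have h1 : (x : V) ∈ U ⊓ W :=
    ⟨x.2, by rw [eq_neg_of_add_eq_zero_left hxw]; exact W.neg_mem w.2⟩
  rw [h, Submodule.mem_bot] at h1
  rw [h1, zero_add] at hxw
  exact ⟨by simpa using h1, by simpa using hxw⟩

lemma add_inj_of_inf_eq_bot {U W : Submodule F V} (h : U ⊓ W = ⊥) {x y : U} {w z : W}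
    (hxy : (x : V) + w = y + z) : x = y ∧ w = z := by
  have := eq_zero_of_add_eq_zero h (x := x - y) (w := w - z) (by
    push_cast
    rw [sub_add_sub_comm, hxy, sub_self])
  exact ⟨sub_eq_zero.1 this.1, sub_eq_zero.1 this.2⟩

lemma finrank_graphIn {U W : Submodule F V} (h : U ⊓ W = ⊥) (f : U →ₗ[F] W) :
    finrank F (graphIn f) = finrank F U := by
  refine LinearMap.finrank_range_of_inj fun x y hxy => ?_
  exact (add_inj_of_inf_eq_bot h (by simpa using hxy)).1

lemma graphIn_inf_eq_bot {U W : Submodule F V} (h : U ⊓ W = ⊥) (f : U →ₗ[F] W) :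
    graphIn f ⊓ W = ⊥ := by
  rw [eq_bot_iff]
  rintro v ⟨hv, hvW⟩
  obtain ⟨x, rfl⟩ := mem_graphIn.1 hv
  have h1 : (x : V) ∈ W := by simpa using W.sub_mem hvW (f x).2
  have h2 : (x : V) ∈ U ⊓ W := ⟨x.2, h1⟩
  rw [h, Submodule.mem_bot] at h2
  have h3 : x = 0 := by simpa using h2
  simp [h3]

lemma graphIn_injective {U W : Submodule F V} (h : U ⊓ W = ⊥) :
    Function.Injective (graphIn : (U →ₗ[F] W) → Submodule F V) := by
  intro f g hfg
  ext1 x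
  have h1 : (x : V) + f x ∈ graphIn g := hfg ▸ mem_graphIn.2 ⟨x, rfl⟩
  obtain ⟨y, hy⟩ := mem_graphIn.1 h1
  obtain ⟨h2, h3⟩ := add_inj_of_inf_eq_bot h hy
  rw [← h3, h2]

/-- Every complement of `W` is the graph of a map from a fixed complement `U₀` of `W` to `W`. -/
lemma exists_graphIn_eq [FiniteDimensional F V] {U₀ U W : Submodule F V} (h₀ : U₀ ⊓ W = ⊥)
    (h : IsCompl U W) (hr : finrank F U = finrank F U₀) : ∃ f : U₀ →ₗ[F] W, graphIn f = U := by
  -- Subtracting from `x` its projection to `W` along `U` leaves a vector of `U`.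
  refine ⟨-(Submodule.projectionOnto W U h.symm ∘ₗ U₀.subtype), ?_⟩
  refine Submodule.eq_of_le_of_finrank_eq (fun v hv => ?_) (by rw [finrank_graphIn h₀, hr])
  obtain ⟨x, rfl⟩ := mem_graphIn.1 hv
  rw [← Submodule.projectionOnto_apply_eq_zero_iff h.symm, map_add,
    Submodule.projectionOnto_apply_left]
  simp

/-- There is a linear family of maps from `U` to `W`, parametrised by `W`, whose nonzero members
are injective (a rank-distance code from multiplication in an extension field). -/
lemma exists_linearMap_forall_injective {F U W : Type*} [Field F] [Finite F] [AddCommGroup U]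
    [Module F U] [AddCommGroup W] [Module F W] [FiniteDimensional F U] [FiniteDimensional F W]
    (h : finrank F U ≤ finrank F W) :
    ∃ φ : W →ₗ[F] U →ₗ[F] W, ∀ w x, φ w x = 0 → w = 0 ∨ x = 0 := by
  rcases Nat.eq_zero_or_pos (finrank F W) with h0 | hpos
  · have := Module.finrank_zero_iff.1 h0
    exact ⟨0, fun w _ _ => Or.inl (Subsingleton.elim _ _)⟩
  obtain ⟨p, hp⟩ := CharP.exists F
  have : Fact p.Prime := ⟨CharP.char_is_prime F p⟩
  have : NeZero (finrank F W) := ⟨hpos.ne'⟩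
  let K := FiniteField.Extension F p (finrank F W)
  have hK : finrank F K = finrank F W := FiniteField.finrank_extension F p _
  let i : W ≃ₗ[F] K := LinearEquiv.ofFinrankEq _ _ hK.symm
  obtain ⟨j, hj⟩ : ∃ j : U →ₗ[F] K, Function.Injective j :=
    finrank_le_iff_exists_linearMap.1 (by rw [hK]; exact h)
  -- With `W` identified with a field `K` and `U` embedded in it, `w` acts by multiplication, which
  -- has no zero divisors.
  refine ⟨(LinearMap.mul F K).compl₁₂ i.toLinearMap j |>.compr₂ i.symm.toLinearMap,
    fun w x hwx => ?_⟩
  have h1 : i w * j x = 0 := by simpa using hwx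
  rcases mul_eq_zero.1 h1 with h2 | h2
  · exact Or.inl (by simpa using h2)
  · exact Or.inr (hj (by simpa using h2))

lemma isCompl_of_inf_eq_bot [FiniteDimensional F V] {U W : Submodule F V} (h : U ⊓ W = ⊥)
    (hr : finrank F V ≤ finrank F U + finrank F W) : IsCompl U W := by
  refine IsCompl.of_eq h (Submodule.eq_top_of_finrank_eq ?_)
  have h1 := Submodule.finrank_sup_add_finrank_inf_eq U W
  rw [h, finrank_bot] at h1
  have h2 := Submodule.finrank_le (U ⊔ W)
  omega

lemma natCard_linearMap [Finite F] [FiniteDimensional F V] (U W : Submodule F V) :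
    Nat.card (U →ₗ[F] W) = Nat.card F ^ (finrank F U * finrank F W) := by
  rw [Module.natCard_eq_pow_finrank (K := F), Module.finrank_linearMap]

variable [Finite F]

lemma pow_le_card_complements [Finite V] [FiniteDimensional F V] (U : Submodule F V) (m : ℕ)
    (hm : finrank F V = m + finrank F U) [DecidablePred fun W : Submodule F V => U ⊓ W = ⊥] :
    Nat.card F ^ (m * finrank F U) ≤
      #{W ∈ subspacesBetween (⊥ : Submodule F V) ⊤ m | U ⊓ W = ⊥} := by
  classical
  obtain ⟨W₀, hW₀⟩ := U.exists_isCompl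
  have hr := Submodule.finrank_add_eq_of_isCompl hW₀
  have hr' : finrank F W₀ = m := by omega
  have hb : W₀ ⊓ U = ⊥ := hW₀.symm.inf_eq_bot
  have : Finite (W₀ →ₗ[F] U) := Module.finite_of_finite F
  have := Fintype.ofFinite (W₀ →ₗ[F] U)
  rw [← hr', ← natCard_linearMap, Nat.card_eq_fintype_card, ← card_univ]
  refine card_le_card_of_injOn graphIn (fun f _ => ?_) (graphIn_injective hb).injOn
  simp only [mem_coe, mem_filter, mem_subspacesBetween, bot_le, le_top, true_and]
  exact ⟨finrank_graphIn hb f, by rw [inf_comm, graphIn_inf_eq_bot hb]⟩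

/-- An intersecting family of common complements of a fixed subspace is small. -/
lemma card_mul_pow_le_of_complements [FiniteDimensional F V] (W : Submodule F V) (k : ℕ)
    (hk1 : 1 ≤ k) (hk : finrank F V = k + finrank F W) (hkW : k ≤ finrank F W) (G : Finset (Submodule F V))
    (hG : ∀ U ∈ G, finrank F U = k ∧ U ⊓ W = ⊥)
    (hint : IsIntersectingFamily (G : Set (Submodule F V))) :
    #G * Nat.card F ^ finrank F W ≤ Nat.card F ^ (k * finrank F W) := by
  classical
  rcases G.eq_empty_or_nonempty with rfl | ⟨U₀, hU₀⟩
  · simp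
  obtain ⟨hr₀, hb₀⟩ := hG U₀ hU₀
  obtain ⟨φ, hφ⟩ := exists_linearMap_forall_injective (F := F) (U := U₀) (W := W) (by omega)
  have hex : ∀ U ∈ G, ∃ f : U₀ →ₗ[F] W, graphIn f = U := fun U hU =>
    exists_graphIn_eq hb₀ (isCompl_of_inf_eq_bot (hG U hU).2 (by rw [(hG U hU).1, hk]))
      (by rw [(hG U hU).1, hr₀])
  choose! f hf using hex
  have : Finite (U₀ →ₗ[F] W) := Module.finite_of_finite F
  let C := LinearMap.range φ
  have : Finite ((U₀ →ₗ[F] W) ⧸ C) := Finite.of_surjective _ C.mkQ_surjective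
  have := Fintype.ofFinite ((U₀ →ₗ[F] W) ⧸ C)
  have hinj : #G ≤ Nat.card ((U₀ →ₗ[F] W) ⧸ C) := by
    rw [Nat.card_eq_fintype_card, ← card_univ]
    refine card_le_card_of_injOn (fun U => C.mkQ (f U)) (fun _ _ => mem_coe.2 (mem_univ _)) ?_
    intro U hU U' hU' hUU'
    -- Graphs sharing a nonzero vector come from maps agreeing at a nonzero point; in one coset of
    -- `C` their difference is then zero.
    by_contra hne
    obtain ⟨v, hv, hv0⟩ := Submodule.exists_mem_ne_zero_of_ne_bot (hint U hU U' hU' hne)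
    obtain ⟨w, hw⟩ := (Submodule.Quotient.eq C).1 hUU'
    have hv1 := hv.1
    have hv2 := hv.2
    rw [← hf U hU] at hv1
    rw [← hf U' hU'] at hv2
    obtain ⟨x, rfl⟩ := mem_graphIn.1 hv1
    obtain ⟨y, hy⟩ := mem_graphIn.1 hv2
    obtain ⟨rfl, h2⟩ := add_inj_of_inf_eq_bot hb₀ hy
    rcases hφ w y (by rw [hw, LinearMap.sub_apply, h2, sub_self]) with rfl | rfl
    · rw [map_zero] at hw
      exact hne (by rw [← hf U hU, ← hf U' hU', sub_eq_zero.1 hw.symm])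
    · simp at hv0
  have hC : Nat.card C = Nat.card F ^ finrank F W := by
    rw [← Module.natCard_eq_pow_finrank (K := F) (V := W)]
    have : Nontrivial U₀ := Module.finrank_pos_iff.1 (by omega : 0 < finrank F U₀)
    obtain ⟨x, hx⟩ := exists_ne (0 : U₀)
    refine Nat.card_congr (LinearEquiv.ofInjective φ ?_).symm.toEquiv
    rw [← LinearMap.ker_eq_bot, LinearMap.ker_eq_bot']
    intro w hw
    exact (hφ w x (by rw [hw]; rfl)).resolve_right hx
  calc #G * Nat.card F ^ finrank F W ≤ Nat.card ((U₀ →ₗ[F] W) ⧸ C) * Nat.card C := by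
        rw [hC]; exact Nat.mul_le_mul_right _ hinj
    _ = Nat.card (U₀ →ₗ[F] W) := by
        rw [mul_comm, Submodule.card_eq_card_quotient_mul_card C]
    _ = _ := by rw [natCard_linearMap, hr₀]

end Complements

/-! ### The weighted inequality and Erdős-Ko-Rado. -/

section ErdosKoRado

variable {F V : Type*} [Field F] [Finite F] [AddCommGroup V] [Module F V] [FiniteDimensional F V]
  [Finite V]

open Module Finset

/-- An intersecting family `G₁` of `k`-subspaces and a family `G₂` of subspaces of complementary
dimension that is cross-intersecting with it. -/
lemma pow_mul_card_add_card_le_gaussBinom {k m : ℕ} (hk : 1 ≤ k) (hkm : k ≤ m)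
    (hV : finrank F V = k + m) (G₁ G₂ : Finset (Submodule F V))
    (hG₁ : ∀ U ∈ G₁, finrank F U = k) (hG₂ : ∀ W ∈ G₂, finrank F W = m)
    (hint : IsIntersectingFamily (G₁ : Set (Submodule F V)))
    (hcross : ∀ U ∈ G₁, ∀ W ∈ G₂, U ⊓ W ≠ ⊥) :
    (Nat.card F : ℝ) ^ m * #G₁ + #G₂ ≤ gaussBinom (Nat.card F) (k + m) k := by
  classical
  set q := Nat.card F
  set T := subspacesBetween (⊥ : Submodule F V) ⊤ m with hT
  have hq : 0 < q := Nat.card_pos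
  have hTcard : (#T : ℝ) = gaussBinom q (k + m) k := by
    have := card_subspacesBetween (F := F) (V := V) m (k + m) (bot_le : ⊥ ≤ ⊤) (by simp [hV])
    rw [finrank_bot, zero_add] at this
    rw [gaussBinom_symm, ← this]
  have hsub : G₂ ⊆ T := fun W hW => by simp [hT, hG₂ W hW]
  have hpow : q ^ (k * m) = q ^ ((k - 1) * m) * q ^ m := by
    rw [← pow_add, ← Nat.succ_mul, Nat.succ_eq_add_one, Nat.sub_add_cancel hk]
  have hdc : #G₁ * q ^ (k * m) ≤ #(T \ G₂) * q ^ ((k - 1) * m) := by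
    refine card_mul_le_card_mul (fun U W => U ⊓ W = ⊥) (fun U hU => ?_) fun W hW => ?_
    · have h1 := pow_le_card_complements U m (by rw [hG₁ U hU, hV, add_comm])
      rw [hG₁ U hU, mul_comm] at h1
      refine h1.trans (card_le_card fun W hW => ?_)
      obtain ⟨h2, h3⟩ := mem_filter.1 hW
      exact mem_filter.2 ⟨mem_sdiff.2 ⟨h2, fun h4 => hcross U hU W h4 h3⟩, h3⟩
    · have hWm : finrank F W = m := (mem_subspacesBetween.1 (mem_sdiff.1 hW).1).2.2
      have h1 := card_mul_pow_le_of_complements W k hk (by rw [hV, hWm]) (by rw [hWm]; exact hkm)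
        (bipartiteBelow (fun U W => U ⊓ W = ⊥) G₁ W)
        (fun U hU => ⟨hG₁ U (mem_filter.1 hU).1, (mem_filter.1 hU).2⟩)
        (fun U hU U' hU' => hint U (mem_filter.1 hU).1 U' (mem_filter.1 hU').1)
      rw [hWm, hpow] at h1
      exact Nat.le_of_mul_le_mul_right h1 (by positivity)
  rw [hpow, ← mul_assoc, mul_right_comm] at hdc
  have h1 : #G₁ * q ^ m ≤ #(T \ G₂) := by
    refine Nat.le_of_mul_le_mul_right (c := q ^ ((k - 1) * m)) ?_ (by positivity)
    linarith
  have h2 : #(T \ G₂) + #G₂ = #T := card_sdiff_add_card_eq_card hsub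
  rw [← hTcard]
  have h3 : q ^ m * #G₁ + #G₂ ≤ #T := by linarith
  exact_mod_cast h3

/-- The Erdős-Ko-Rado theorem for vector spaces over finite fields. -/
lemma card_le_gaussBinom_of_isIntersectingFamily {k m : ℕ} (hkm : k ≤ m)
    (hV : finrank F V = (k + 1) + (m + 1)) (G : Finset (Submodule F V))
    (hG : ∀ U ∈ G, finrank F U = k + 1)
    (hint : IsIntersectingFamily (G : Set (Submodule F V))) :
    (#G : ℝ) ≤ gaussBinom (Nat.card F) (k + m + 1) k := by
  classical
  by_contra! hlt
  -- `m - k` steps lead from dimension `k + 1` to the complementary dimension `m + 1`.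
  have h1 := gaussBinom_le_card_overspaces (k + m + 1) k (by rw [hV]; ring) G hG hlt.le (m - k)
    (by omega)
  rw [Nat.add_sub_cancel' hkm] at h1
  have h2 := pow_mul_card_add_card_le_gaussBinom (by omega) (by omega) hV G
    {W ∈ subspacesBetween (⊥ : Submodule F V) ⊤ (m + 1) | ∃ U ∈ G, U ≤ W} hG
    (fun W hW => (mem_subspacesBetween.1 (mem_filter.1 hW).1).2.2) hint ?_
  · have h3 := gaussBinom_pascal (Nat.card F) k m
    have h4 := gaussBinom_symm (Nat.card F) (k + 1) m
    rw [show k + 1 + m = k + m + 1 by ring] at h4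
    rw [show k + 1 + (m + 1) = k + m + 1 + 1 by ring] at h2
    have hp : (0 : ℝ) < (Nat.card F : ℝ) ^ (m + 1) := by
      have : 0 < Nat.card F := Nat.card_pos
      positivity
    have h5 := mul_lt_mul_of_pos_left hlt hp
    linarith
  · intro U hU W hW hbot
    obtain ⟨-, U', hU', hle⟩ := mem_filter.1 hW
    have hUbot : U ≠ ⊥ := fun h => by
      have := hG U hU
      rw [h, finrank_bot] at this
      omega
    -- Intersecting says nothing about equal members, so `U = U'` needs `U ≠ ⊥`.
    by_cases hUU' : U = U'
    · exact hUbot (by rw [← hbot, inf_eq_left.2 (hUU' ▸ hle)])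
    · exact hint U hU U' hU' hUU' (eq_bot_iff.2 (hbot ▸ inf_le_inf_left U hle))

end ErdosKoRado

theorem corollary2p3 {F V : Type*} [Field F] [Fintype F] [AddCommGroup V] [Module F V]
    [FiniteDimensional F V] (q n k : ℕ)
    (hq : Fintype.card F = q) (hn : Module.finrank F V = n)
    (hk : 1 ≤ k) (hkn : 2 * k ≤ n)
    (G₁ G₂ : Finset (Submodule F V))
    (hG₁ : ∀ U ∈ G₁, Module.finrank F U = k)
    (hG₂ : ∀ U ∈ G₂, Module.finrank F U = n - k)
    (hG : IsIntersectingFamily ((G₁ : Set (Submodule F V)) ∪ (G₂ : Set (Submodule F V))))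
    (α : ℝ) (hα : (if 2 * k = n then (1 : ℝ) else (q : ℝ) ^ (n - k)) ≤ α) :
    α * (G₁.card : ℝ) + (G₂.card : ℝ)
        ≤ α * gaussBinom q (n - 1) (k - 1) + gaussBinom q (n - 1) k ∧
      (α * (G₁.card : ℝ) + (G₂.card : ℝ)
          = α * gaussBinom q (n - 1) (k - 1) + gaussBinom q (n - 1) k →
        gaussBinom q (n - 1) k ≤ (G₂.card : ℝ)) := by
  have : Finite V := Module.finite_of_finite F
  obtain ⟨k, rfl⟩ := Nat.exists_eq_add_of_le' hk
  obtain ⟨m, rfl⟩ : ∃ m, n = (k + 1) + (m + 1) := ⟨n - (k + 1) - 1, by omega⟩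
  have hkm : k ≤ m := by omega
  rw [← Nat.card_eq_fintype_card] at hq
  subst hq
  rw [Nat.add_sub_cancel_left] at hG₂ hα
  rw [show k + 1 + (m + 1) - 1 = k + m + 1 by omega, Nat.add_sub_cancel]
  have hint₁ : IsIntersectingFamily (G₁ : Set (Submodule F V)) :=
    fun U hU W hW => hG U (Or.inl hU) W (Or.inl hW)
  have hint₂ : IsIntersectingFamily (G₂ : Set (Submodule F V)) :=
    fun U hU W hW => hG U (Or.inr hU) W (Or.inr hW)
  have h₁ := card_le_gaussBinom_of_isIntersectingFamily hkm hn G₁ hG₁ hint₁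
  have hα0 : 0 ≤ α := le_trans (by split_ifs <;> positivity) hα
  refine ⟨?_, fun heq => by linarith [mul_le_mul_of_nonneg_left h₁ hα0]⟩
  split_ifs at hα with hif
  · obtain rfl : m = k := by omega
    have h₂ := card_le_gaussBinom_of_isIntersectingFamily hkm hn G₂ hG₂ hint₂
    have h3 := gaussBinom_symm (Nat.card F) (m + 1) m
    rw [show m + 1 + m = m + m + 1 by ring] at h3
    linarith [mul_le_mul_of_nonneg_left h₁ hα0]
  · have h₂ := pow_mul_card_add_card_le_gaussBinom hk (by omega) hn G₁ G₂ hG₁ hG₂ hint₁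
      -- The dimensions differ as `2k ≠ n`, so `U` and `W` are distinct.
      fun U hU W hW => hG U (Or.inl hU) W (Or.inr hW) fun h => by
        have h4 := hG₁ U hU
        have h5 := hG₂ W hW
        rw [h] at h4
        omega
    rw [show k + 1 + (m + 1) = k + m + 1 + 1 by ring, gaussBinom_pascal] at h₂
    have h3 := mul_le_mul_of_nonneg_left h₁ (sub_nonneg.2 hα)
    linarith
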